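/- **Setting.** Processes $\mathbb{P}$ share a global clock with times in $\mathbb{N}$ and communicate over a directed graph of channels. Every channel $i\mapsto j$ has transmission bounds $1\le \min_{ij}\le\max_{ij}\le\infty$, and we write $b_{ij}=\max_{ij}$. In a *context* $\gamma$, at every time $t$ process $i$ observes the external inputs and the messages arriving at $(i,t)$, updates its local state $r_i(t)$ (which contains the current time $t$), and then acts, sending at most one message on each outgoing channel. The context fixes the possible initial memories and the state-update functions. A *protocol* $P$ assigns to every local state of every process a nonempty set of permitted actions (a singleton if $P$ is deterministic). The *system* ${\cal R}(P,\gamma)$ is the set of all runs in which processes act according to $P$, local states evolve according to $\gamma$, the environment chooses the external inputs freely (each one possible only at the processes for which $\gamma$ allows it and occurring at most once in a run), and each message sent on a channel $i\mapsto j$ is received after a transit time in $[\min_{ij},\max_{ij}]$ chosen by the environment. $\gamma^{\mathsf f}$ denotes a *Fixed-delivery* context: $\min_{ij}=\max_{ij}<\infty$ for all channels, so that every message on $i\mapsto j$ takes exactly $b_{ij}$ time units. An event occurring at $(i,t)$ in $r$ is an *ND event* if it is an external input, or an early receive, i.e. the receipt of a message sent at time $s$ on a channel $j\mapsto i$ with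 $t<s+b_{ji}$. The fact $\mathsf{ndocc}(e)$ holds at $(r,t)$ if $e$ occurs as an ND event in $r$ at some time $\le t$. For a system ${\cal R}$, $({\cal R},r,t)\vDash K_i\varphi$ iff $({\cal R},r',t')\vDash\varphi$ for all $r'\in{\cal R}$ and all $t'$ with $r'_i(t')=r_i(t)$. $\mathsf D(i,j)\in\mathbb{N}\cup\{\infty\}$ is the minimal weight of a directed path from $i$ to $j$ in the network with edge weights $b_{ij}$ ($\mathsf D(i,i)=0$, and $\infty$ if there is no path), and $(i,t)\dashrightarrow(j,t')$ means $t+\mathsf D(i,j)\le t'$. **Lemma.** Let $P$ be an arbitrary protocol, let $\gamma^{\mathsf f}$ be a Fixed-delivery context, let ${\cal R}^{\mathsf f}={\cal R}(P,\gamma^{\mathsf f})$ and $r\in{\cal R}^{\mathsf f}$. Let $i_0,\dots,i_k\in\mathbb{P}$ with $k\ge 0$, let $t,t'\in\mathbb{N}$, and let $e$ be an ND event occurring at $(i_0,t)$ in $r$. If $$({\cal R}^{\mathsf f},r,t')\vDash K_{i_k}K_{i_{k-1}}\cdots K_{i_1}\mathsf{ndocc}(e),$$ then $(i_0,t)\dashrightarrow(i_h,t')$,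 that is, $t+\mathsf D(i_0,i_h)\le t'$, for all $h\le k$. -/

import Mathlib

namespace SyncSys

/-- A network: a directed graph of channels; a message on the channel from `i` to `j` spends at
least `lower i j` and at most `upper i j` (possibly `⊤`) time units in transit. Values off the
channels are irrelevant. -/
structure Network (ℙ : Type*) where
  chan : Digraph ℙ
  lower : ℙ → ℙ → ℕ
  upper : ℙ → ℙ → ℕ∞
  one_le_lower : ∀ i j, chan.Adj i j → 1 ≤ lower i j
  lower_le_upper : ∀ i j, chan.Adj i j → (lower i j : ℕ∞) ≤ upper i j

/-- `N.WalkWeight i j w`: there is a directed walk from `i` to `j` whose total weight is `w`, each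
channel being weighted by its upper bound. -/
inductive Network.WalkWeight {ℙ : Type*} (N : Network ℙ) : ℙ → ℙ → ℕ∞ → Prop
  | nil (i : ℙ) : N.WalkWeight i i 0
  | cons {i j k : ℙ} {w : ℕ∞} (hij : N.chan.Adj i j) (hjk : N.WalkWeight j k w) :
      N.WalkWeight i k (N.upper i j + w)

/-- Transmission distance: the minimal weight of a directed walk (`⊤` if there is none). -/
noncomputable def Network.transDist {ℙ : Type*} (N : Network ℙ) (i j : ℙ) : ℕ∞ :=
  sInf {w | N.WalkWeight i j w}

/-- Bound guarantee between the process-time nodes `α = (i, t)` and `β = (j, t')`: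
`t + D(i, j) ≤ t'`. -/
def Network.BoundGuarantee {ℙ : Type*} (N : Network ℙ) (α β : ℙ × ℕ) : Prop :=
  (α.2 : ℕ∞) + N.transDist α.1 β.1 ≤ (β.2 : ℕ∞)

/-- Fixed delivery: the lower and the upper bound of every channel coincide (in particular the
upper bound is finite). -/
def Network.FixedDelivery {ℙ : Type*} (N : Network ℙ) : Prop :=
  ∀ i j, N.chan.Adj i j → (N.lower i j : ℕ∞) = N.upper i j

/-- What a process does at one time: at most one message to each process (only those
along channels are transmitted), and a set of internal actions. -/
structure Action (ℙ Msg Act : Type*) where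
  send : ℙ → Option Msg
  internal : Set Act

/-- A message together with the data that identify it in a run. -/
structure Message (ℙ Msg : Type*) where
  sender : ℙ
  receiver : ℙ
  sentAt : ℕ
  content : Msg

/-- Local states: the current global time is a component of every local state; `S i` is the
set of possible memory contents of process `i`. -/
abbrev LocalState {ℙ : Type*} (S : ℙ → Type*) (i : ℙ) : Type _ := ℕ × S i

/-- A synchronous context with bounds on message transmission. `inputs i` are the external inputs
that `i` may get, `initial` the set of possible initial memories. The memory of `i` at time `0` is
obtained by `start` from its initial memory and the external inputs at time `0`; the memory at time
`t + 1` is obtained by `step` from the local state and the action at time `t`, and the external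
inputs and the messages that arrive at time `t + 1`. -/
structure Context (ℙ Msg Act Ext : Type*) (S : ℙ → Type*) where
  net : Network ℙ
  inputs : ℙ → Set Ext
  initial : Set (∀ i, S i)
  start : ∀ i, S i → Set Ext → S i
  step : ∀ i, LocalState S i → Action ℙ Msg Act → Set Ext → Set (Message ℙ Msg) → S i

/-- A (possibly nondeterministic) protocol: the nonempty set of permitted actions
as a function of the local state. -/
structure Protocol (ℙ Msg Act : Type*) (S : ℙ → Type*) where
  permitted : ∀ i, LocalState S i → Set (Action ℙ Msg Act)
  nonempty : ∀ i l, (permitted i l).Nonempty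

/-- A candidate run: memories and actions of the processes, and the choices of the environment,
namely the external inputs at each node and the transit time of the message (if any) sent from `i`
to `j` at time `s`. -/
structure Run (ℙ Msg Act Ext : Type*) (S : ℙ → Type*) where
  mem : ∀ i, ℕ → S i
  act : ℙ → ℕ → Action ℙ Msg Act
  input : ℙ → ℕ → Set Ext
  transit : ℙ → ℙ → ℕ → ℕ

section

variable {ℙ Msg Act Ext : Type*} {S : ℙ → Type*}

/-- The local state `r_i(t)`. -/
def Run.localState (r : Run ℙ Msg Act Ext S) (i : ℙ) (t : ℕ) : LocalState S i := (t, r.mem i t)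

/-- The message `m` is sent in `r` (by its sender, to its receiver, at time `m.sentAt`). -/
def Run.Sent (γ : Context ℙ Msg Act Ext S) (r : Run ℙ Msg Act Ext S) (m : Message ℙ Msg) : Prop :=
  γ.net.chan.Adj m.sender m.receiver ∧
    (r.act m.sender m.sentAt).send m.receiver = some m.content

/-- The messages received at the node `(j, t)`. -/
def Run.received (γ : Context ℙ Msg Act Ext S) (r : Run ℙ Msg Act Ext S) (j : ℙ) (t : ℕ) :
    Set (Message ℙ Msg) :=
  {m | r.Sent γ m ∧ m.receiver = j ∧ m.sentAt + r.transit m.sender m.receiver m.sentAt = t}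

/-- `r` is a run of the protocol `P` in the context `γ`. -/
structure IsRun (P : Protocol ℙ Msg Act S) (γ : Context ℙ Msg Act Ext S)
    (r : Run ℙ Msg Act Ext S) : Prop where
  mem_zero : ∃ q ∈ γ.initial, ∀ i, r.mem i 0 = γ.start i (q i) (r.input i 0)
  mem_succ : ∀ i t, r.mem i (t + 1) =
    γ.step i (r.localState i t) (r.act i t) (r.input i (t + 1)) (r.received γ i (t + 1))
  act_mem : ∀ i t, r.act i t ∈ P.permitted i (r.localState i t)
  input_sub : ∀ i t, r.input i t ⊆ γ.inputs i
  /-- Events are distinct: an external input occurs at most once in a run. -/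
  input_unique : ∀ x i t j s, x ∈ r.input i t → x ∈ r.input j s → i = j ∧ t = s
  transit_bounds : ∀ m, r.Sent γ m →
    γ.net.lower m.sender m.receiver ≤ r.transit m.sender m.receiver m.sentAt ∧
    (r.transit m.sender m.receiver m.sentAt : ℕ∞) ≤ γ.net.upper m.sender m.receiver

/-- The system `R(P, γ)`: the set of all runs of `P` in `γ`. -/
def system (P : Protocol ℙ Msg Act S) (γ : Context ℙ Msg Act Ext S) :
    Set (Run ℙ Msg Act Ext S) := {r | IsRun P γ r}

/-- Events. All of them occur at most once in a run. -/
inductive Event (ℙ Msg Act Ext : Type*) where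
  | input (x : Ext)
  | receive (m : Message ℙ Msg)
  | send (m : Message ℙ Msg)
  | internal (i : ℙ) (s : ℕ) (a : Act)

/-- The event occurs at the node `(i, t)` in `r`. -/
def Run.OccursAt (γ : Context ℙ Msg Act Ext S) (r : Run ℙ Msg Act Ext S) (i : ℙ) (t : ℕ) :
    Event ℙ Msg Act Ext → Prop
  | .input x => x ∈ r.input i t
  | .receive m => m ∈ r.received γ i t
  | .send m => r.Sent γ m ∧ m.sender = i ∧ m.sentAt = t
  | .internal j s a => j = i ∧ s = t ∧ a ∈ (r.act i t).internal

/-- The kind of event that is nondeterministic if it occurs at time `t`: an external input, or an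
early receive, i.e. the receipt of a message strictly before its upper bound elapses. -/
def NDKind (γ : Context ℙ Msg Act Ext S) (t : ℕ) : Event ℙ Msg Act Ext → Prop
  | .input _ => True
  | .receive m => (t : ℕ∞) < (m.sentAt : ℕ∞) + γ.net.upper m.sender m.receiver
  | .send _ => False
  | .internal _ _ _ => False

/-- `e` is an ND event at the node `(i, t)` in `r`. -/
def Run.IsNDAt (γ : Context ℙ Msg Act Ext S) (r : Run ℙ Msg Act Ext S)
    (e : Event ℙ Msg Act Ext) (i : ℙ) (t : ℕ) : Prop :=
  r.OccursAt γ i t e ∧ NDKind γ t e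

/-- Facts are interpreted at points `(r, t)`. -/
abbrev Fact (ℙ Msg Act Ext : Type*) (S : ℙ → Type*) : Type _ :=
  Run ℙ Msg Act Ext S → ℕ → Prop

/-- `ndocc(e)`: by now, `e` has occurred as an ND event. -/
def ndocc (γ : Context ℙ Msg Act Ext S) (e : Event ℙ Msg Act Ext) : Fact ℙ Msg Act Ext S :=
  fun r t => ∃ i s, s ≤ t ∧ r.IsNDAt γ e i s

/-- `K_i φ` in the system `R`: `φ` holds at all points of `R` at which `i` has the
same local state. -/
def Knows (R : Set (Run ℙ Msg Act Ext S)) (i : ℙ) (φ : Fact ℙ Msg Act Ext S) :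
    Fact ℙ Msg Act Ext S :=
  fun r t => ∀ r' ∈ R, ∀ t', r'.localState i t' = r.localState i t → φ r' t'

/-- `K_{i_k} K_{i_{k-1}} ⋯ K_{i_1} φ`. -/
def nestedKnows (R : Set (Run ℙ Msg Act Ext S)) (i : ℕ → ℙ) (φ : Fact ℙ Msg Act Ext S) :
    ℕ → Fact ℙ Msg Act Ext S
  | 0 => φ
  | k + 1 => Knows R (i (k + 1)) (nestedKnows R i φ k)

end

end SyncSys

namespace SyncSys

section Distance

variable {ℙ : Type*} {N : Network ℙ}

/-! With fixed delivery the only ND events are external inputs (`exists_input_of_isNDAt`), and a run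
is determined by its initial memories, inputs and choices of action. Deleting one input while
repeating the old choices wherever the local state is unchanged gives another run, and the change
spreads no faster than the messages, so it stays inside the region bound guaranteed by the input's
node (`exists_without_input`). A process outside that region cannot tell the two runs apart, hence
does not know that the input occurred. Since knowledge implies truth, the nested formula yields such
knowledge for each `i h` with `1 ≤ h ≤ k` at time `t'` in the same run. -/

theorem Network.WalkWeight.snoc {i j k : ℙ} {w : ℕ∞} (hij : N.WalkWeight i j w)
    (hjk : N.chan.Adj j k) : N.WalkWeight i k (w + N.upper j k) := by
  induction hij with
  | nil i => simpa using Network.WalkWeight.cons hjk (Network.WalkWeight.nil k)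
  | cons hab _ ih => simpa [add_assoc] using Network.WalkWeight.cons hab (ih hjk)

@[simp]
theorem Network.transDist_self (i : ℙ) : N.transDist i i = 0 :=
  le_antisymm (sInf_le (Network.WalkWeight.nil i)) zero_le

theorem Network.transDist_le_add_upper (i : ℙ) {j k : ℙ} (hjk : N.chan.Adj j k) :
    N.transDist i k ≤ N.transDist i j + N.upper j k := by
  rcases Set.eq_empty_or_nonempty {w | N.WalkWeight i j w} with h | h
  · simp [Network.transDist, h]
  -- `ℕ∞` is well-ordered, so the infimum is attained by a walk.
  · exact sInf_le ((csInf_mem h : N.WalkWeight i j (N.transDist i j)).snoc hjk)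

theorem Network.BoundGuarantee.mono {α : ℙ × ℕ} {j : ℙ} {s u : ℕ}
    (h : N.BoundGuarantee α (j, s)) (hsu : s ≤ u) : N.BoundGuarantee α (j, u) :=
  h.trans (Nat.cast_le.2 hsu)

theorem Network.BoundGuarantee.self (i : ℙ) {s u : ℕ} (hsu : s ≤ u) :
    N.BoundGuarantee (i, s) (i, u) := by
  simpa [Network.BoundGuarantee] using hsu

/-- A bound guarantee extends along a channel whose delivery time is its upper bound. -/
theorem Network.BoundGuarantee.deliver (hN : N.FixedDelivery) {α : ℙ × ℕ} {j k : ℙ} {s : ℕ}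
    (h : N.BoundGuarantee α (j, s)) (hjk : N.chan.Adj j k) :
    N.BoundGuarantee α (k, s + N.lower j k) := by
  have h1 := N.transDist_le_add_upper α.1 hjk
  unfold Network.BoundGuarantee at h ⊢
  calc (α.2 : ℕ∞) + N.transDist α.1 k
      ≤ (α.2 : ℕ∞) + (N.transDist α.1 j + N.upper j k) := by gcongr
    _ = (α.2 : ℕ∞) + N.transDist α.1 j + N.upper j k := (add_assoc _ _ _).symm
    _ ≤ (s : ℕ∞) + N.upper j k := by gcongr
    _ = ((s + N.lower j k : ℕ) : ℕ∞) := by rw [← hN j k hjk]; push_cast; rfl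

end Distance

section Generate

variable {ℙ Msg Act Ext : Type*} {S : ℙ → Type*}

/-- The memories that result from the initial memories `q`, the external inputs `inp`, and actions
chosen by `c` as a function of the local state, when every message has minimal transit time. -/
noncomputable def generatedMem (γ : Context ℙ Msg Act Ext S)
    (c : ∀ i, LocalState S i → Action ℙ Msg Act) (q : ∀ i, S i) (inp : ℙ → ℕ → Set Ext) :
    ℕ → ∀ i, S i
  | 0 => fun i => γ.start i (q i) (inp i 0)
  | n + 1 => fun i =>
      γ.step i (n, generatedMem γ c q inp n i) (c i (n, generatedMem γ c q inp n i)) (inp i (n + 1))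
        -- The bound on `m.sentAt` makes the recursion well founded; it excludes no message, as
        -- transit times are at least 1.
        {m | (γ.net.chan.Adj m.sender m.receiver ∧ ∃ _ : m.sentAt < n + 1,
            (c m.sender (m.sentAt, generatedMem γ c q inp m.sentAt m.sender)).send m.receiver =
              some m.content) ∧
          m.receiver = i ∧ m.sentAt + γ.net.lower m.sender m.receiver = n + 1}
termination_by n => n

/-- The run generated by initial memories, external inputs and a choice of actions. -/
noncomputable def generatedRun (γ : Context ℙ Msg Act Ext S)
    (c : ∀ i, LocalState S i → Action ℙ Msg Act) (q : ∀ i, S i) (inp : ℙ → ℕ → Set Ext) :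
    Run ℙ Msg Act Ext S where
  mem i n := generatedMem γ c q inp n i
  act i n := c i (n, generatedMem γ c q inp n i)
  input := inp
  transit i j _ := γ.net.lower i j

/-- Produces the altered run: a changed input can affect all later memories, so they have to be
recomputed from time 0. -/
theorem generatedRun_isRun {P : Protocol ℙ Msg Act S} {γ : Context ℙ Msg Act Ext S}
    {c : ∀ i, LocalState S i → Action ℙ Msg Act} {q : ∀ i, S i} {inp : ℙ → ℕ → Set Ext}
    (hc : ∀ i l, c i l ∈ P.permitted i l) (hq : q ∈ γ.initial)
    (hsub : ∀ i t, inp i t ⊆ γ.inputs i)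
    (huniq : ∀ x i t j s, x ∈ inp i t → x ∈ inp j s → i = j ∧ t = s) :
    IsRun P γ (generatedRun γ c q inp) where
  mem_zero := ⟨q, hq, fun i => by simp [generatedRun, generatedMem]⟩
  mem_succ i n := by
    change generatedMem γ c q inp (n + 1) i = _
    rw [generatedMem]
    refine congrArg (γ.step i _ _ _) ?_
    ext m
    simp only [Run.received, Run.Sent, generatedRun, Set.mem_ofPred_eq]
    constructor
    · rintro ⟨⟨ha, _, hs⟩, hr⟩
      exact ⟨⟨ha, hs⟩, hr⟩
    · rintro ⟨⟨ha, hs⟩, hr⟩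
      have := γ.net.one_le_lower _ _ ha
      exact ⟨⟨ha, by lia, hs⟩, hr⟩
  act_mem i n := hc i _
  input_sub := hsub
  input_unique := huniq
  transit_bounds m hm := ⟨le_rfl, γ.net.lower_le_upper _ _ hm.1⟩

end Generate

section Runs

variable {ℙ Msg Act Ext : Type*} {S : ℙ → Type*}
  {P : Protocol ℙ Msg Act S} {γ : Context ℙ Msg Act Ext S}

theorem IsRun.transit_eq_lower (hγ : γ.net.FixedDelivery) {r : Run ℙ Msg Act Ext S}
    (hr : IsRun P γ r) {m : Message ℙ Msg} (hm : r.Sent γ m) :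
    r.transit m.sender m.receiver m.sentAt = γ.net.lower m.sender m.receiver := by
  obtain ⟨h1, h2⟩ := hr.transit_bounds m hm
  rw [← hγ _ _ hm.1] at h2
  exact le_antisymm (Nat.cast_le.1 h2) h1

/-- In a fixed-delivery context the only ND events are external inputs. -/
theorem IsRun.exists_input_of_isNDAt (hγ : γ.net.FixedDelivery) {r : Run ℙ Msg Act Ext S}
    (hr : IsRun P γ r) {e : Event ℙ Msg Act Ext} {i : ℙ} {t : ℕ} (he : r.IsNDAt γ e i t) :
    ∃ x, e = .input x ∧ x ∈ r.input i t := by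
  obtain ⟨ho, hk⟩ := he
  cases e with
  | input x => exact ⟨x, rfl, ho⟩
  | receive m =>
    obtain ⟨hs, -, ht⟩ := ho
    rw [hr.transit_eq_lower hγ hs] at ht
    simp only [NDKind, ← ht, ← hγ _ _ hs.1, Nat.cast_add, lt_self_iff_false] at hk
  | send m => exact hk.elim
  | internal j s a => exact hk.elim

/-- Let two runs in a fixed-delivery context have the same initial memories, and let equal
memories lead to equal actions. If their external inputs differ at most at the node `α`, then
their memories agree outside the region bound guaranteed by `α`. -/
theorem mem_eq_of_not_boundGuarantee (hγ : γ.net.FixedDelivery) {r r' : Run ℙ Msg Act Ext S}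
    (hr : IsRun P γ r) (hr' : IsRun P γ r') (h0 : ∀ i, r.input i 0 = r'.input i 0 →
      r.mem i 0 = r'.mem i 0)
    (hact : ∀ i s, r.mem i s = r'.mem i s → r.act i s = r'.act i s) {α : ℙ × ℕ}
    (hinp : ∀ i s, (i, s) ≠ α → r.input i s = r'.input i s) (s : ℕ) :
    ∀ i, ¬ γ.net.BoundGuarantee α (i, s) → r.mem i s = r'.mem i s := by
  have hin : ∀ i s, ¬ γ.net.BoundGuarantee α (i, s) → r.input i s = r'.input i s := by
    intro i s h
    refine hinp i s ?_
    rintro rfl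
    exact h (.self i le_rfl)
  induction s using Nat.strong_induction_on with
  | _ s ih =>
  intro i hi
  cases s with
  | zero => exact h0 i (hin i 0 hi)
  | succ s =>
    have hs : r.mem i s = r'.mem i s :=
      ih s s.lt_succ_self i fun h => hi (h.mono s.le_succ)
    have hrec : r.received γ i (s + 1) = r'.received γ i (s + 1) := by
      have key : ∀ m : Message ℙ Msg, γ.net.chan.Adj m.sender m.receiver → m.receiver = i →
          m.sentAt + γ.net.lower m.sender m.receiver = s + 1 →
          r.act m.sender m.sentAt = r'.act m.sender m.sentAt := by
        rintro m ha rfl ht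
        have hl := γ.net.one_le_lower _ _ ha
        -- A guarantee reaching the sender would be carried to `i` by the message. The message may
        -- have been sent long before, hence the strong induction.
        refine hact _ _ (ih _ (by lia) _ fun h => hi ?_)
        rw [← ht]
        exact h.deliver hγ ha
      ext m
      constructor
      · rintro ⟨hm, hi', ht⟩
        rw [hr.transit_eq_lower hγ hm] at ht
        have hm' : r'.Sent γ m := ⟨hm.1, by rw [← key m hm.1 hi' ht]; exact hm.2⟩
        exact ⟨hm', hi', by rw [hr'.transit_eq_lower hγ hm', ht]⟩
      · rintro ⟨hm, hi', ht⟩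
        rw [hr'.transit_eq_lower hγ hm] at ht
        have hm' : r.Sent γ m := ⟨hm.1, by rw [key m hm.1 hi' ht]; exact hm.2⟩
        exact ⟨hm', hi', by rw [hr.transit_eq_lower hγ hm', ht]⟩
    rw [hr.mem_succ, hr'.mem_succ, hin i _ hi, hrec, hact i s hs]
    simp only [Run.localState, hs]

/-- An external input can be removed from a run without affecting the memories outside the region
bound guaranteed by its node. -/
theorem IsRun.exists_without_input (hγ : γ.net.FixedDelivery) {r : Run ℙ Msg Act Ext S}
    (hr : IsRun P γ r) {x : Ext} {i : ℙ} {t : ℕ} (hx : x ∈ r.input i t) :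
    ∃ r', IsRun P γ r' ∧ (∀ j s, x ∉ r'.input j s) ∧
      ∀ j s, ¬ γ.net.BoundGuarantee (i, t) (j, s) → r'.localState j s = r.localState j s := by
  classical
  obtain ⟨q, hq, hq0⟩ := hr.mem_zero
  -- `P` may be nondeterministic: `c` copies the action of `r` where the memory matches and is an
  -- arbitrary permitted one elsewhere.
  let c : ∀ i, LocalState S i → Action ℙ Msg Act := fun j l =>
    if l.2 = r.mem j l.1 then r.act j l.1 else (P.nonempty j l).some
  let inp : ℙ → ℕ → Set Ext := fun j s => r.input j s \ {x}
  have hc : ∀ j l, c j l ∈ P.permitted j l := by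
    rintro j ⟨n, m⟩
    by_cases h : m = r.mem j n
    · subst h
      simpa [c, Run.localState] using hr.act_mem j n
    · simpa [c, h] using (P.nonempty j (n, m)).some_mem
  have hr' : IsRun P γ (generatedRun γ c q inp) := generatedRun_isRun hc hq
    (fun j s => Set.sdiff_subset.trans (hr.input_sub j s))
    (fun y j s j' s' h h' => hr.input_unique y j s j' s' h.1 h'.1)
  refine ⟨_, hr', fun j s h => h.2 rfl, fun j s h => ?_⟩
  refine Prod.ext rfl (mem_eq_of_not_boundGuarantee hγ hr hr' ?_ ?_ ?_ s j h).symm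
  · intro j hj
    rw [hq0, hj]
    simp [generatedRun, generatedMem]
  · intro j n hn
    change _ = c j (n, (generatedRun γ c q inp).mem j n)
    simp [c, ← hn]
  · intro j n hn
    -- An input occurs at most once, so removing `x` everywhere alters only the node `(i, t)`.
    refine (Set.sdiff_singleton_eq_self fun h => hn ?_).symm
    obtain ⟨rfl, rfl⟩ := hr.input_unique x j n i t h hx
    rfl

end Runs

section Knowledge

variable {ℙ Msg Act Ext : Type*} {S : ℙ → Type*} {R : Set (Run ℙ Msg Act Ext S)}

/-- Knowledge is truthful at the actual point, so outer operators can be stripped without moving to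
another run or time. -/
theorem nestedKnows_of_le {i : ℕ → ℙ} {φ : Fact ℙ Msg Act Ext S} {h k : ℕ} (hhk : h ≤ k)
    {r : Run ℙ Msg Act Ext S} (hr : r ∈ R) {t : ℕ} (hK : nestedKnows R i φ k r t) :
    nestedKnows R i φ h r t := by
  induction k, hhk using Nat.le_induction with
  | base => exact hK
  | succ k _ ih => exact ih (hK r hr t rfl)

/-- Here truthfulness is applied beneath the outermost operator. -/
theorem knows_of_nestedKnows {i : ℕ → ℙ} {φ : Fact ℙ Msg Act Ext S} {h : ℕ}
    {r : Run ℙ Msg Act Ext S} {t : ℕ} (hK : nestedKnows R i φ (h + 1) r t) :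
    Knows R (i (h + 1)) φ r t :=
  fun r' hr' t' ht' => nestedKnows_of_le (Nat.zero_le h) hr' (hK r' hr' t' ht')

end Knowledge

end SyncSys

theorem mainTheorem8 {ℙ Msg Act Ext : Type*} {S : ℙ → Type*}
    (P : SyncSys.Protocol ℙ Msg Act S) (γ : SyncSys.Context ℙ Msg Act Ext S)
    (hγ : γ.net.FixedDelivery)
    (r : SyncSys.Run ℙ Msg Act Ext S) (hr : r ∈ SyncSys.system P γ)
    (k : ℕ) (i : ℕ → ℙ) (e : SyncSys.Event ℙ Msg Act Ext) (t t' : ℕ)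
    (he : r.IsNDAt γ e (i 0) t)
    (hK : SyncSys.nestedKnows (SyncSys.system P γ) i (SyncSys.ndocc γ e) k r t') :
    ∀ h ≤ k, γ.net.BoundGuarantee (i 0, t) (i h, t') := by
  have hrun : SyncSys.IsRun P γ r := hr
  obtain ⟨x, rfl, hx⟩ := hrun.exists_input_of_isNDAt hγ he
  intro h hh
  have hKh := SyncSys.nestedKnows_of_le hh hr hK
  cases h with
  | zero =>
    -- No operator is left: the input has occurred by `t'`, and its uniqueness makes that occurrence
    -- the one at `(i 0, t)`.
    obtain ⟨j, s, hs, hj, -⟩ := hKh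
    obtain ⟨-, rfl⟩ := hrun.input_unique x _ _ _ _ hx hj
    exact .self _ hs
  | succ h =>
    by_contra hb
    obtain ⟨r', hr', hno, hloc⟩ := hrun.exists_without_input hγ hx
    obtain ⟨j, s, -, hj, -⟩ := SyncSys.knows_of_nestedKnows hKh r' hr' t' (hloc _ _ hb)
    exact hno j s hj
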